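/- Let $A$ be a noetherian Krull domain, that is, a noetherian integral domain with $A=\bigcap_{\mathfrak p}A_{\mathfrak p}$, where $\mathfrak p$ runs over the height one primes of $A$, such that every such $A_{\mathfrak p}$ is a discrete valuation ring and every nonzero $x\in A$ is a unit in $A_{\mathfrak p}$ for all but finitely many $\mathfrak p$. Let $B=A[[t]]$ be the ring of formal power series in one variable over $A$ (again a noetherian Krull domain). For $R\in\{A,B\}$, an $R$-module is called pseudo-null if it is finitely generated and torsion and its annihilator has height at least $2$ (the unit ideal has height $\infty$, so $0$ is pseudo-null); a pseudo-isomorphism is an $R$-linear map with pseudo-null kernel and cokernel. Every finitely generated torsion $R$-module $N$ admits a pseudo-isomorphism $N\to\bigoplus_{i=1}^n R/\mathfrak p_i^{e_i}$ with $\mathfrak p_i$ height one primes of $R$ (not necessarily distinct) and $e_i\ge 1$, where $n$ and the pairs $(\mathfrak p_i,e_i)$ are unique up to order; put $Ch_R(N)=\prod_{i=1}^n\mathfrak p_i^{e_i}$. If $N$ is finitely generated and not torsion, put $Ch_R(N)=0$. Let $M$ be a finitely generated torsion $B$-module such that $M/tM$ is a finitely generated torsion $A$-module, and let $M_t$ be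 the kernel of multiplication by $t$ on $M$ (a finitely generated $A$-module). Then $M$ is a pseudo-null $B$-module if and only if $$Ch_A(M_t)=Ch_A(M/tM).$$ Moreover, if $M/tM$ is a pseudo-null $A$-module, then $M$ is a pseudo-null $B$-module. -/

import Mathlib

open scoped PowerSeries Pointwise

/-- The set of height one primes of `A`, as a type. -/
abbrev HeightOnePrime (A : Type*) [CommRing A] : Type _ :=
  {p : PrimeSpectrum A // p.asIdeal.height = 1}

/-- A domain `A` is a Krull domain if every localization `A_p` at a height one prime is a discrete
valuation ring, `A` is the intersection of the `A_p` inside its fraction field, and every nonzero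
`x : A` is a unit in `A_p` for all but finitely many height one primes `p`. (Fields are Krull
domains: there the intersection is over the empty set and equals the fraction field.) -/
structure IsKrullDomain (A : Type*) [CommRing A] [IsDomain A] : Prop where
  isDiscreteValuationRing : ∀ p : HeightOnePrime A,
    IsDiscreteValuationRing (Localization.AtPrime p.1.asIdeal)
  iInf_localization : ⨅ p : HeightOnePrime A,
    Localization.subalgebra.ofField (FractionRing A) p.1.asIdeal.primeCompl
      (Ideal.primeCompl_le_nonZeroDivisors p.1.asIdeal) = ⊥
  finite_not_isUnit : ∀ x : A, x ≠ 0 →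
    {p : HeightOnePrime A |
      ¬ IsUnit (algebraMap A (Localization.AtPrime p.1.asIdeal) x)}.Finite

/-- A pseudo-null module: a finitely generated torsion module whose annihilator has height at
least `2` (the unit ideal has height `⊤`, so the zero module is pseudo-null). -/
structure IsPseudoNull (A M : Type*) [CommRing A] [AddCommGroup M] [Module A M] : Prop where
  finite : Module.Finite A M
  isTorsion : Module.IsTorsion A M
  two_le_height : 2 ≤ (Module.annihilator A M).height

/-- A pseudo-isomorphism: a linear map with pseudo-null kernel and cokernel. -/
structure IsPseudoIso {A M N : Type*} [CommRing A] [AddCommGroup M] [Module A M]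
    [AddCommGroup N] [Module A N] (f : M →ₗ[A] N) : Prop where
  ker : IsPseudoNull A (LinearMap.ker f)
  coker : IsPseudoNull A (N ⧸ LinearMap.range f)

/-- A finite list `(p₁, e₁), …, (pₙ, eₙ)` of height one primes of `A` (not necessarily distinct)
with positive exponents. -/
structure ElementaryData (A : Type*) [CommRing A] where
  n : ℕ
  prime : Fin n → HeightOnePrime A
  exp : Fin n → ℕ
  exp_pos : ∀ i, 0 < exp i

/-- The elementary module `A/p₁^e₁ ⊕ … ⊕ A/pₙ^eₙ`. -/
abbrev ElementaryData.Mod {A : Type*} [CommRing A] (D : ElementaryData A) : Type _ :=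
  (i : Fin D.n) → A ⧸ (D.prime i).1.asIdeal ^ D.exp i

/-- The ideal `p₁^e₁ ⋯ pₙ^eₙ`. -/
def ElementaryData.ideal {A : Type*} [CommRing A] (D : ElementaryData A) : Ideal A :=
  ∏ i : Fin D.n, (D.prime i).1.asIdeal ^ D.exp i

open Classical in
/-- The characteristic ideal `Ch_A(M)` of a finitely generated module `M` over a noetherian Krull
domain `A`: it is `0` if `M` is not torsion, and it is `p₁^e₁ ⋯ pₙ^eₙ` if `M` is torsion and
pseudo-isomorphic to `A/p₁^e₁ ⊕ … ⊕ A/pₙ^eₙ`. For finitely generated torsion modules over a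
noetherian Krull domain such an elementary module always exists and is unique up to the order of
its summands, so the inner `else` branch is never reached there and the choice is immaterial. -/
noncomputable def charIdeal (A M : Type*) [CommRing A] [AddCommGroup M] [Module A M] : Ideal A :=
  if Module.IsTorsion A M then
    if h : ∃ D : ElementaryData A, ∃ f : M →ₗ[A] D.Mod, IsPseudoIso f then h.choose.ideal else ⊥
  else ⊥

/-! Everything is read off from lengths at the height one primes `p` of `A`: two finitely generated
torsion `A`-modules have the same characteristic ideal if and only if their localizations at every
such `p` have the same length. For a `B`-module `N` put
`χ_p(N) = length (N / XN)_p - length (N[X])_p`. The snake lemma makes `χ_p` additive in short exact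
sequences, and so a prime filtration reduces the theorem to showing, for a prime `P` of `B`
containing a power series with nonzero constant coefficient, that `χ_p(B / P) ≥ 0` for all `p` and
that all `χ_p(B / P)` vanish precisely when `P` has height at least two.

If `X ∈ P`, then `X` kills `B / P`, and `P` is strictly larger than the height one prime `(X)`.
If `X ∉ P`, then `(B / P)[X] = 0`, while `(B / P) / X (B / P)` is `A` modulo the ideal `P(0)` of
constant coefficients of `P`. It remains to see that a `P` of height one has `P(0) ⊆ p` for some
`p`. Write `P = (b) : c`. If `P(0)` lies in no `p`, an element of the fraction field of `A` that
multiplies `P(0)` into `A` lies in `A`; hence `(b) : P ⊆ (b) + X ((b) : P)`, and Nakayama's lemma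
gives `c ∈ (b)`, which is absurd.
-/

section LocalLength

variable {A : Type*} [CommRing A] (p : Ideal A) [p.IsPrime]

/-- The length over `A_p` of the localization of the `A`-module `N` at the prime `p`. -/
noncomputable def localLength (N : Type*) [AddCommGroup N] [Module A N] : ℕ∞ :=
  Module.length (Localization.AtPrime p) (LocalizedModule p.primeCompl N)

variable {N N₁ N₂ N₃ : Type*} [AddCommGroup N] [Module A N] [AddCommGroup N₁] [Module A N₁]
  [AddCommGroup N₂] [Module A N₂] [AddCommGroup N₃] [Module A N₃]

theorem localLength_eq_of_isLocalizedModule {N' : Type*} [AddCommGroup N'] [Module A N']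
    [Module (Localization.AtPrime p) N'] [IsScalarTower A (Localization.AtPrime p) N']
    (f : N →ₗ[A] N') [IsLocalizedModule p.primeCompl f] :
    localLength p N = Module.length (Localization.AtPrime p) N' :=
  (LinearEquiv.extendScalarsOfIsLocalization p.primeCompl (Localization.AtPrime p)
    (IsLocalizedModule.iso p.primeCompl f)).length_eq

theorem localLength_congr (e : N₁ ≃ₗ[A] N₂) : localLength p N₁ = localLength p N₂ :=
  localLength_eq_of_isLocalizedModule p
    (LocalizedModule.mkLinearMap p.primeCompl N₂ ∘ₗ e.toLinearMap)

theorem localLength_eq_zero_iff_subsingleton :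
    localLength p N = 0 ↔ Subsingleton (LocalizedModule p.primeCompl N) :=
  Module.length_eq_zero_iff

theorem localLength_eq_zero_iff_of_finite [Module.Finite A N] :
    localLength p N = 0 ↔ ¬ Module.annihilator A N ≤ p := by
  have mem_support := Module.mem_support_iff (R := A) (M := N) (p := ⟨p, inferInstance⟩)
  rw [Module.support_eq_zeroLocus, ← not_subsingleton_iff_nontrivial] at mem_support
  rw [localLength_eq_zero_iff_subsingleton]
  exact (not_iff_comm.1 mem_support.symm).symm

theorem localLength_quotient_eq_zero {I : Ideal A} (h : ¬ I ≤ p) : localLength p (A ⧸ I) = 0 := by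
  rwa [localLength_eq_zero_iff_of_finite, Ideal.annihilator_quotient]

theorem localLength_quotient_pow_self [IsDomain A]
    [IsDiscreteValuationRing (Localization.AtPrime p)] (e : ℕ) :
    localLength p (A ⧸ p ^ e) = e := by
  rw [localLength_eq_of_isLocalizedModule p (Submodule.toLocalizedQuotient'
    (Localization.AtPrime p) p.primeCompl (Algebra.linearMap A (Localization.AtPrime p)) (p ^ e)),
    Ideal.localized'_eq_map, Ideal.map_pow, Localization.AtPrime.map_eq_maximalIdeal]
  exact IsDiscreteValuationRing.length_quotient_pow_maximalIdeal _ e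

theorem localLength_pi {ι : Type*} [Fintype ι] (F : ι → Type*) [∀ i, AddCommGroup (F i)]
    [∀ i, Module A (F i)] : localLength p (∀ i, F i) = ∑ i, localLength p (F i) := by
  rw [localLength_eq_of_isLocalizedModule p (LinearMap.pi fun i =>
    LocalizedModule.mkLinearMap p.primeCompl (F i) ∘ₗ LinearMap.proj i),
    Module.length_pi_of_fintype]
  rfl

theorem localLength_eq_add_of_exact (f : N₁ →ₗ[A] N₂) (g : N₂ →ₗ[A] N₃)
    (hf : Function.Injective f) (hg : Function.Surjective g) (hfg : Function.Exact f g) :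
    localLength p N₂ = localLength p N₁ + localLength p N₃ :=
  Module.length_eq_add_of_exact _ _ (LocalizedModule.map_injective p.primeCompl f hf)
    (LocalizedModule.map_surjective p.primeCompl g hg)
    (LocalizedModule.map_exact p.primeCompl f g hfg)

theorem localLength_eq_ker_add_range (f : N₁ →ₗ[A] N₂) :
    localLength p N₁ = localLength p (LinearMap.ker f) + localLength p (LinearMap.range f) :=
  localLength_eq_add_of_exact p (LinearMap.ker f).subtype f.rangeRestrict
    (LinearMap.ker f).subtype_injective f.surjective_rangeRestrict fun x => by
      simp [Subtype.ext_iff]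

theorem localLength_add_add_eq_of_exact {K₁ K₂ K₃ C₁ C₂ C₃ : Type*}
    [AddCommGroup K₁] [Module A K₁] [AddCommGroup K₂] [Module A K₂] [AddCommGroup K₃] [Module A K₃]
    [AddCommGroup C₁] [Module A C₁] [AddCommGroup C₂] [Module A C₂] [AddCommGroup C₃] [Module A C₃]
    {f₁ : K₁ →ₗ[A] K₂} {f₂ : K₂ →ₗ[A] K₃} {δ : K₃ →ₗ[A] C₁} {g₁ : C₁ →ₗ[A] C₂}
    {g₂ : C₂ →ₗ[A] C₃} (hf₁ : Function.Injective f₁) (hf : Function.Exact f₁ f₂)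
    (hfδ : Function.Exact f₂ δ) (hδg : Function.Exact δ g₁) (hg : Function.Exact g₁ g₂)
    (hg₂ : Function.Surjective g₂) :
    localLength p K₁ + localLength p K₃ + localLength p C₂ =
      localLength p K₂ + localLength p C₁ + localLength p C₃ := by
  rw [localLength_eq_ker_add_range p f₂, localLength_eq_ker_add_range p δ,
    localLength_eq_ker_add_range p g₁, localLength_eq_ker_add_range p g₂,
    hf.linearMap_ker_eq, hfδ.linearMap_ker_eq, hδg.linearMap_ker_eq, hg.linearMap_ker_eq,
    localLength_congr p (LinearEquiv.ofInjective f₁ hf₁),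
    localLength_congr p (LinearEquiv.ofTop _ (LinearMap.range_eq_top.2 hg₂))]
  ac_rfl

variable {p} {f : N₁ →ₗ[A] N₂}

theorem localLength_ker_eq_zero_iff : localLength p (LinearMap.ker f) = 0 ↔
    Function.Injective (LocalizedModule.map p.primeCompl f) := by
  have h_inj := LocalizedModule.map_injective p.primeCompl (LinearMap.ker f).subtype
    (LinearMap.ker f).subtype_injective
  have h_exact : Function.Exact (LocalizedModule.map p.primeCompl (LinearMap.ker f).subtype)
      (LocalizedModule.map p.primeCompl f) :=
    LocalizedModule.map_exact p.primeCompl _ _ (LinearMap.exact_subtype_ker_map f)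
  rw [localLength_eq_zero_iff_subsingleton, ← LinearMap.ker_eq_bot, h_exact.linearMap_ker_eq,
    (LinearEquiv.ofInjective _ h_inj).toEquiv.subsingleton_congr, Submodule.subsingleton_iff_eq_bot]

theorem localLength_coker_eq_zero_iff : localLength p (N₂ ⧸ LinearMap.range f) = 0 ↔
    Function.Surjective (LocalizedModule.map p.primeCompl f) := by
  have h_surj := LocalizedModule.map_surjective p.primeCompl (LinearMap.range f).mkQ
    (LinearMap.range f).mkQ_surjective
  have h_exact : Function.Exact (LocalizedModule.map p.primeCompl f)
      (LocalizedModule.map p.primeCompl (LinearMap.range f).mkQ) :=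
    LocalizedModule.map_exact p.primeCompl _ _ (LinearMap.exact_map_mkQ_range f)
  rw [localLength_eq_zero_iff_subsingleton, ← LinearMap.range_eq_top, ← h_exact.linearMap_ker_eq,
    ← (LinearMap.quotKerEquivOfSurjective _ h_surj).toEquiv.subsingleton_congr,
    Submodule.Quotient.subsingleton_iff]

theorem localLength_eq_of_bijective_map
    (hf : Function.Bijective (LocalizedModule.map p.primeCompl f)) :
    localLength p N₁ = localLength p N₂ :=
  (LinearEquiv.ofBijective _ hf).length_eq

end LocalLength

section PseudoNull

theorem two_le_height_iff {A : Type*} [CommRing A] (I : Ideal A) :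
    2 ≤ I.height ↔ ∀ p : PrimeSpectrum A, p.asIdeal.height ≤ 1 → ¬ I ≤ p.asIdeal := by
  constructor
  · intro hI p hp hIp
    exact absurd ((hI.trans (Ideal.height_mono hIp)).trans hp) (by decide)
  · intro h
    by_contra! hlt
    obtain ⟨n, hn⟩ := ENat.ne_top_iff_exists.1 (ne_top_of_lt hlt)
    obtain ⟨J, hJ, hIJ, hJn⟩ := Ideal.exists_isPrime_height_eq hn.symm
    refine h ⟨J, hJ⟩ ?_ hIJ
    rw [← hn] at hlt
    rw [hJn]
    exact Order.le_of_lt_add_one hlt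

variable {A : Type*} [CommRing A] [IsDomain A]
variable {N N₁ N₂ : Type*} [AddCommGroup N] [Module A N] [AddCommGroup N₁] [Module A N₁]
  [AddCommGroup N₂] [Module A N₂]

theorem isTorsion_iff_annihilator_ne_bot [Module.Finite A N] :
    Module.IsTorsion A N ↔ Module.annihilator A N ≠ ⊥ := by
  constructor
  · intro h
    obtain ⟨a, ha, ha0⟩ := Submodule.annihilator_top_inter_nonZeroDivisors h
    rw [SetLike.mem_coe, Submodule.annihilator_top] at ha
    exact (Submodule.ne_bot_iff _).2 ⟨a, ha, nonZeroDivisors.ne_zero ha0⟩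
  · intro h x
    obtain ⟨a, ha, ha0⟩ := (Submodule.ne_bot_iff _).1 h
    exact ⟨⟨a, mem_nonZeroDivisors_of_ne_zero ha0⟩, Module.mem_annihilator.1 ha x⟩

theorem isPseudoNull_iff_two_le_height [Module.Finite A N] :
    IsPseudoNull A N ↔ 2 ≤ (Module.annihilator A N).height := by
  refine ⟨IsPseudoNull.two_le_height, fun h => ⟨inferInstance, ?_, h⟩⟩
  rw [isTorsion_iff_annihilator_ne_bot]
  intro h_bot
  simp [h_bot] at h

theorem isPseudoNull_iff [Module.Finite A N] : IsPseudoNull A N ↔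
    ∀ p : PrimeSpectrum A, p.asIdeal.height ≤ 1 → localLength p.asIdeal N = 0 := by
  simp_rw [isPseudoNull_iff_two_le_height, two_le_height_iff, localLength_eq_zero_iff_of_finite]

theorem isPseudoNull_congr [Module.Finite A N₁] [Module.Finite A N₂] (e : N₁ ≃ₗ[A] N₂) :
    IsPseudoNull A N₁ ↔ IsPseudoNull A N₂ := by
  rw [isPseudoNull_iff_two_le_height, isPseudoNull_iff_two_le_height, e.annihilator_eq]

theorem isPseudoNull_iff_of_exact {N₃ : Type*} [AddCommGroup N₃] [Module A N₃]
    [Module.Finite A N₁] [Module.Finite A N₂] [Module.Finite A N₃] {f : N₁ →ₗ[A] N₂}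
    {g : N₂ →ₗ[A] N₃} (hf : Function.Injective f) (hg : Function.Surjective g)
    (hfg : Function.Exact f g) : IsPseudoNull A N₂ ↔ IsPseudoNull A N₁ ∧ IsPseudoNull A N₃ := by
  simp_rw [isPseudoNull_iff, localLength_eq_add_of_exact _ f g hf hg hfg, add_eq_zero, imp_and,
    forall_and]

theorem IsPseudoNull.localLength_eq_zero (h : IsPseudoNull A N) (p : HeightOnePrime A) :
    localLength p.1.asIdeal N = 0 :=
  have := h.finite
  isPseudoNull_iff.1 h p.1 p.2.le

theorem isPseudoIso_iff_bijective [IsNoetherianRing A] [Module.Finite A N₁] [Module.Finite A N₂]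
    (f : N₁ →ₗ[A] N₂) : IsPseudoIso f ↔ ∀ p : PrimeSpectrum A, p.asIdeal.height ≤ 1 →
      Function.Bijective (LocalizedModule.map p.asIdeal.primeCompl f) := by
  simp_rw [Function.Bijective, ← localLength_ker_eq_zero_iff, ← localLength_coker_eq_zero_iff,
    imp_and, forall_and, ← isPseudoNull_iff]
  exact ⟨fun h => ⟨h.ker, h.coker⟩, fun h => ⟨h.1, h.2⟩⟩

end PseudoNull

section ElementaryData

variable {A : Type*} [CommRing A]

theorem HeightOnePrime.coe_eq_of_le (q : HeightOnePrime A) {p : PrimeSpectrum A}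
    (hp : p.asIdeal.height ≤ 1) (hqp : q.1.asIdeal ≤ p.asIdeal) : q.1 = p := by
  have : q.1.asIdeal.FiniteHeight := ⟨Or.inr (by simp [q.2])⟩
  exact PrimeSpectrum.ext (Ideal.eq_of_le_of_height_le _ hqp (hp.trans q.2.ge))

theorem HeightOnePrime.pow_le_iff {q p : HeightOnePrime A} {e : ℕ} (he : e ≠ 0) :
    q.1.asIdeal ^ e ≤ p.1.asIdeal ↔ q = p := by
  rw [Ideal.IsPrime.pow_le_iff he]
  exact ⟨fun h => Subtype.ext (q.coe_eq_of_le p.2.le h), fun h => h ▸ le_rfl⟩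

namespace ElementaryData

open Classical in
/-- The multiplicity of `p` in `p₁^e₁ ⋯ pₙ^eₙ`: the sum of the `eᵢ` with `pᵢ = p`. -/
noncomputable def mult (D : ElementaryData A) (p : HeightOnePrime A) : ℕ :=
  ∑ i with D.prime i = p, D.exp i

theorem localLength_mod [IsDomain A] (D : ElementaryData A) (p : HeightOnePrime A)
    [IsDiscreteValuationRing (Localization.AtPrime p.1.asIdeal)] :
    localLength p.1.asIdeal D.Mod = D.mult p := by
  classical
  rw [localLength_pi, mult, Nat.cast_sum, Finset.sum_filter]
  refine Finset.sum_congr rfl fun i _ => ?_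
  split_ifs with h
  · rw [h, localLength_quotient_pow_self]
  · exact localLength_quotient_eq_zero _ (mt (HeightOnePrime.pow_le_iff (D.exp_pos i).ne').1 h)

theorem ideal_eq_finprod_mult (D : ElementaryData A) :
    D.ideal = ∏ᶠ p : HeightOnePrime A, p.1.asIdeal ^ D.mult p := by
  classical
  have h_support : Function.mulSupport (fun p => p.1.asIdeal ^ D.mult p) ⊆
      Finset.univ.image D.prime := by
    intro p hp
    contrapose! hp
    have h_empty : Finset.univ.filter (D.prime · = p) = ∅ := by
      simpa [Finset.filter_eq_empty_iff] using hp
    simp [mult, h_empty]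
  rw [finprod_eq_prod_of_mulSupport_subset _ h_support, ideal,
    ← Finset.prod_fiberwise_of_maps_to fun i _ =>
      Finset.mem_image_of_mem D.prime (Finset.mem_univ i)]
  refine Finset.prod_congr rfl fun p _ => ?_
  rw [mult, ← Finset.prod_pow_eq_pow_sum]
  exact Finset.prod_congr (by congr) fun i hi => by rw [(Finset.mem_filter.1 hi).2]

theorem map_ideal (D : ElementaryData A) (p : HeightOnePrime A) :
    D.ideal.map (algebraMap A (Localization.AtPrime p.1.asIdeal)) =
      IsLocalRing.maximalIdeal (Localization.AtPrime p.1.asIdeal) ^ D.mult p := by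
  classical
  rw [ideal, ← Ideal.mapHom_apply, map_prod, mult, ← Finset.prod_pow_eq_pow_sum, Finset.prod_filter]
  refine Finset.prod_congr rfl fun i _ => ?_
  split_ifs with h
  · rw [Ideal.mapHom_apply, h, Ideal.map_pow, Localization.AtPrime.map_eq_maximalIdeal]
  · rw [Ideal.mapHom_apply, Ideal.one_eq_top]
    contrapose h
    rw [← HeightOnePrime.pow_le_iff (D.exp_pos i).ne']
    exact Set.disjoint_compl_left_iff_subset.1
      ((IsLocalization.map_algebraMap_ne_top_iff_disjoint p.1.asIdeal.primeCompl _ _).1 h)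

theorem exists_equiv_mod {ι : Type*} [Finite ι] (q : ι → HeightOnePrime A) (e : ι → ℕ) :
    ∃ D : ElementaryData A, Nonempty ((∀ i, A ⧸ (q i).1.asIdeal ^ e i) ≃ₗ[A] D.Mod) := by
  classical
  have := Fintype.ofFinite ι
  let σ := (Fintype.equivFin {i // 0 < e i}).symm
  let r : (∀ i, A ⧸ (q i).1.asIdeal ^ e i) →ₗ[A]
      (∀ i : {i // 0 < e i}, A ⧸ (q i).1.asIdeal ^ e i) :=
    LinearMap.pi fun i => LinearMap.proj i.1
  have hr : Function.Bijective r := by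
    constructor
    · intro x y hxy
      ext i
      by_cases hi : 0 < e i
      · exact congrFun hxy ⟨i, hi⟩
      · have : Subsingleton (A ⧸ (q i).1.asIdeal ^ e i) := by
          rw [Nat.eq_zero_of_not_pos hi, pow_zero, Ideal.one_eq_top]
          infer_instance
        exact Subsingleton.elim _ _
    · intro y
      refine ⟨fun i => if hi : 0 < e i then y ⟨i, hi⟩ else 0, ?_⟩
      ext i
      simp [r, i.2]
  exact ⟨⟨_, fun i => q (σ i), fun i => e (σ i), fun i => (σ i).2⟩,
    ⟨LinearEquiv.ofBijective r hr ≪≫ₗ LinearEquiv.piCongrLeft' A _ σ.symm⟩⟩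

end ElementaryData

theorem IsKrullDomain.ideal_eq_iff [IsDomain A] (hA : IsKrullDomain A) (D D' : ElementaryData A) :
    D.ideal = D'.ideal ↔ ∀ p, D.mult p = D'.mult p := by
  refine ⟨fun h p => ?_, fun h => ?_⟩
  · have := hA.isDiscreteValuationRing p
    apply (Ideal.pow_right_strictAnti _ (IsDiscreteValuationRing.not_a_field _)
      (IsLocalRing.maximalIdeal.isMaximal (Localization.AtPrime p.1.asIdeal)).ne_top).injective
    simp only [← ElementaryData.map_ideal, h]
  · simp_rw [ElementaryData.ideal_eq_finprod_mult, h]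

end ElementaryData

section StructureTheorem

variable {A : Type*} [CommRing A]

theorem isTorsion_localizedModule (S : Submonoid A) {N : Type*} [AddCommGroup N] [Module A N]
    (hN : Module.IsTorsion A N) : Module.IsTorsion (Localization S) (LocalizedModule S N) := by
  intro x
  induction x with
  | h x s =>
    obtain ⟨⟨a, ha⟩, hax⟩ := @hN x
    refine ⟨⟨algebraMap A (Localization S) a, IsLocalization.nonZeroDivisors_le_comap S _ ha⟩, ?_⟩
    change algebraMap A (Localization S) a • LocalizedModule.mk x s = 0
    rw [algebraMap_smul, LocalizedModule.smul'_mk, show a • x = 0 from hax, LocalizedModule.zero_mk]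

theorem coe_localizedModule_map_comp (S : Submonoid A) {N N' N'' : Type*} [AddCommGroup N]
    [Module A N] [AddCommGroup N'] [Module A N'] [AddCommGroup N''] [Module A N'']
    (g : N' →ₗ[A] N'') (f : N →ₗ[A] N') : ⇑(LocalizedModule.map S (g ∘ₗ f)) =
      LocalizedModule.map S g ∘ LocalizedModule.map S f := by
  funext x
  induction x with
  | h x s => simp only [Function.comp_apply, LocalizedModule.map_mk, LinearMap.comp_apply]

theorem exists_bijective_localizedModule_map (S : Submonoid A) {N N' : Type*}
    [AddCommGroup N] [Module A N] [Module.FinitePresentation A N] [AddCommGroup N'] [Module A N']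
    (E : LocalizedModule S N ≃ₗ[A] LocalizedModule S N') :
    ∃ f : N →ₗ[A] N', Function.Bijective (LocalizedModule.map S f) := by
  obtain ⟨f, s, hf, -⟩ := Module.exists_localizedMap_surjective_of_surjective S
    (LocalizedModule.mkLinearMap S N) (LocalizedModule.mkLinearMap S N') (ϕ := E.toLinearMap)
    E.surjective
  have smul_bijective := (Module.End.isUnit_iff _).1
    (IsLocalizedModule.map_units (LocalizedModule.mkLinearMap S N') s)
  refine ⟨f, ?_⟩
  convert! smul_bijective.comp E.bijective using 1
  exact congrArg DFunLike.coe hf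

theorem bijective_localizedModule_map_proj {ι : Type*} [Finite ι] {F : ι → Type*}
    [∀ i, AddCommGroup (F i)] [∀ i, Module A (F i)] (p : Ideal A) [p.IsPrime] (i : ι)
    (h : ∀ j ≠ i, localLength p (F j) = 0) : Function.Bijective
      (LocalizedModule.map p.primeCompl (LinearMap.proj i : (∀ j, F j) →ₗ[A] F i)) := by
  have := Fintype.ofFinite ι
  classical
  let rest : LinearMap.ker (LinearMap.proj i : (∀ j, F j) →ₗ[A] F i) →ₗ[A]
      (∀ j : {j // j ≠ i}, F j) :=
    (LinearMap.pi fun j => LinearMap.proj j.1) ∘ₗ Submodule.subtype _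
  have h_inj : Function.Injective rest := fun x y hxy => by
    ext j
    obtain rfl | hj := eq_or_ne j i
    · exact x.2.trans y.2.symm
    · exact congrFun hxy ⟨j, hj⟩
  refine ⟨localLength_ker_eq_zero_iff.1 (le_bot_iff.1 ?_),
    LocalizedModule.map_surjective _ _ (LinearMap.proj_surjective i)⟩
  calc _ ≤ localLength p (∀ j : {j // j ≠ i}, F j) :=
        Module.length_le_of_injective _ (LocalizedModule.map_injective _ rest h_inj)
    _ = 0 := by rw [localLength_pi]; exact Finset.sum_eq_zero fun j _ => h j j.2

theorem bijective_localizedModule_map_pi {ι : Type*} [Finite ι] {F : ι → Type*}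
    [∀ i, AddCommGroup (F i)] [∀ i, Module A (F i)] {N : Type*} [AddCommGroup N] [Module A N]
    {p : Ideal A} [p.IsPrime] {f : ∀ i, N →ₗ[A] F i} (i : ι)
    (h : ∀ j ≠ i, localLength p (F j) = 0)
    (hf : Function.Bijective (LocalizedModule.map p.primeCompl (f i))) :
    Function.Bijective (LocalizedModule.map p.primeCompl (LinearMap.pi f)) := by
  rwa [← (bijective_localizedModule_map_proj p i h).of_comp_iff', ← coe_localizedModule_map_comp]

theorem bijective_localizedModule_map_of_localLength_eq_zero {N N' : Type*} [AddCommGroup N]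
    [Module A N] [AddCommGroup N'] [Module A N'] {p : Ideal A} [p.IsPrime]
    (hN : localLength p N = 0) (f : N →ₗ[A] N') (hN' : localLength p N' = 0) :
    Function.Bijective (LocalizedModule.map p.primeCompl f) := by
  rw [localLength_eq_zero_iff_subsingleton] at hN hN'
  exact ⟨Function.injective_of_subsingleton _, Function.surjective_to_subsingleton _⟩

theorem exists_bijective_map_pi_quotient_pow [IsDomain A] [IsNoetherianRing A]
    {N : Type*} [AddCommGroup N] [Module A N] [Module.Finite A N] (hN : Module.IsTorsion A N)
    (p : Ideal A) [p.IsPrime] [IsDiscreteValuationRing (Localization.AtPrime p)] :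
    ∃ (k : ℕ) (e : Fin k → ℕ) (f : N →ₗ[A] ∀ i, A ⧸ p ^ e i),
      Function.Bijective (LocalizedModule.map p.primeCompl f) := by
  let R := Localization.AtPrime p
  let S := p.primeCompl
  obtain ⟨ι, _, ϖ, hϖ, e, ⟨E⟩⟩ :=
    Module.equiv_directSum_of_isTorsion (isTorsion_localizedModule S hN)
  have span_pow (n : ℕ) (i : ι) : R ∙ ϖ i ^ n =
      Submodule.localized' R S (Algebra.linearMap A R) (p ^ n) := by
    rw [Ideal.localized'_eq_map, Ideal.map_pow, Localization.AtPrime.map_eq_maximalIdeal,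
      (IsDiscreteValuationRing.irreducible_iff_uniformizer _).1 (hϖ i), Ideal.span_singleton_pow]
  let σ := (Fintype.equivFin ι).symm
  let e' := fun i => e (σ i)
  let E' : LocalizedModule S N ≃ₗ[R]
      (∀ i, R ⧸ Submodule.localized' R S (Algebra.linearMap A R) (p ^ e' i)) :=
    E ≪≫ₗ DirectSum.linearEquivFunOnFintype R ι _ ≪≫ₗ LinearEquiv.piCongrLeft' R _ σ.symm ≪≫ₗ
      LinearEquiv.piCongrRight fun i => Submodule.quotEquivOfEq _ _ (span_pow _ _)
  let g : (∀ i, A ⧸ p ^ e' i) →ₗ[A]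
      (∀ i, R ⧸ Submodule.localized' R S (Algebra.linearMap A R) (p ^ e' i)) :=
    LinearMap.pi fun i => Submodule.toLocalizedQuotient' R S (Algebra.linearMap A R) (p ^ e' i) ∘ₗ
      LinearMap.proj i
  have : IsLocalizedModule S g := IsLocalizedModule.pi S _
  have := Module.finitePresentation_of_finite A N
  exact ⟨_, e', exists_bijective_localizedModule_map S
    (E'.restrictScalars A ≪≫ₗ (IsLocalizedModule.iso S g).symm)⟩

variable [IsDomain A]

theorem IsKrullDomain.finite_setOf_mem (hA : IsKrullDomain A) {a : A} (ha : a ≠ 0) :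
    {p : HeightOnePrime A | a ∈ p.1.asIdeal}.Finite := by
  refine (hA.finite_not_isUnit a ha).subset fun p hp => ?_
  rwa [Set.mem_ofPred_eq, IsLocalization.AtPrime.isUnit_to_map_iff _ p.1.asIdeal,
    Ideal.mem_primeCompl_iff, not_not]

variable [IsNoetherianRing A] {N N' : Type*} [AddCommGroup N] [Module A N] [Module.Finite A N]
  [AddCommGroup N'] [Module A N'] [Module.Finite A N']

theorem IsKrullDomain.exists_isPseudoIso (hA : IsKrullDomain A) (hN : Module.IsTorsion A N) :
    ∃ (D : ElementaryData A) (f : N →ₗ[A] D.Mod), IsPseudoIso f := by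
  obtain ⟨a, ha, ha0⟩ := (Submodule.ne_bot_iff _).1 (isTorsion_iff_annihilator_ne_bot.1 hN)
  let T := {p : HeightOnePrime A // a ∈ p.1.asIdeal}
  have : Fintype T := (hA.finite_setOf_mem ha0).fintype
  have local_structure (p : HeightOnePrime A) :=
    have := hA.isDiscreteValuationRing p
    exists_bijective_map_pi_quotient_pow hN p.1.asIdeal
  choose k e f hf using local_structure
  obtain ⟨D, ⟨E⟩⟩ := ElementaryData.exists_equiv_mod
    (fun i : Σ p : T, Fin (k p.1) => i.1.1) fun i => e i.1.1 i.2
  let F : N →ₗ[A] ∀ q : T, ∀ j, A ⧸ q.1.1.asIdeal ^ e q.1 j := LinearMap.pi fun q => f q.1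
  have localLength_eq_zero {p : PrimeSpectrum A} (hp : p.asIdeal.height ≤ 1) (q : T)
      (hqp : q.1.1 ≠ p) : localLength p.asIdeal (∀ j, A ⧸ q.1.1.asIdeal ^ e q.1 j) = 0 := by
    rw [localLength_pi]
    exact Finset.sum_eq_zero fun j _ => localLength_quotient_eq_zero _ fun h =>
      hqp (q.1.coe_eq_of_le hp (p.isPrime.le_of_pow_le h))
  have hF (p : PrimeSpectrum A) (hp : p.asIdeal.height ≤ 1) :
      Function.Bijective (LocalizedModule.map p.asIdeal.primeCompl F) := by
    by_cases hap : a ∈ p.asIdeal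
    · have p_ne_bot : p.asIdeal ≠ ⊥ := (Submodule.ne_bot_iff _).2 ⟨a, hap, ha0⟩
      let q : T := ⟨⟨p, hp.antisymm (Order.one_le_iff_ne_zero.2
        (Ideal.height_eq_zero_iff_eq_bot.not.2 p_ne_bot))⟩, hap⟩
      exact bijective_localizedModule_map_pi q (fun q' hne => localLength_eq_zero hp q' fun h =>
        hne (Subtype.ext (Subtype.ext h))) (hf q.1)
    · refine bijective_localizedModule_map_of_localLength_eq_zero
        ((localLength_eq_zero_iff_of_finite _).2 fun h => hap (h ha)) F ?_
      rw [localLength_pi]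
      exact Finset.sum_eq_zero fun q _ => localLength_eq_zero hp q fun h => hap (h ▸ q.2)
  let E' := (LinearEquiv.piCurry A fun (q : T) j => A ⧸ q.1.1.asIdeal ^ e q.1 j).symm ≪≫ₗ E
  refine ⟨D, E'.toLinearMap ∘ₗ F, (isPseudoIso_iff_bijective _).2 fun p hp => ?_⟩
  rw [coe_localizedModule_map_comp]
  exact .comp ⟨LocalizedModule.map_injective _ _ E'.injective,
    LocalizedModule.map_surjective _ _ E'.surjective⟩ (hF p hp)

theorem IsPseudoIso.localLength_eq_mult {D : ElementaryData A} {f : N →ₗ[A] D.Mod}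
    (hf : IsPseudoIso f) (p : HeightOnePrime A)
    [IsDiscreteValuationRing (Localization.AtPrime p.1.asIdeal)] :
    localLength p.1.asIdeal N = D.mult p := by
  rw [← D.localLength_mod p]
  exact localLength_eq_of_bijective_map ((isPseudoIso_iff_bijective f).1 hf p.1 p.2.le)

theorem IsKrullDomain.exists_charIdeal_eq (hA : IsKrullDomain A) (hN : Module.IsTorsion A N) :
    ∃ D : ElementaryData A, charIdeal A N = D.ideal ∧
      ∀ p : HeightOnePrime A, localLength p.1.asIdeal N = D.mult p := by
  have h := hA.exists_isPseudoIso hN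
  refine ⟨h.choose, by rw [charIdeal, if_pos hN, dif_pos h], fun p => ?_⟩
  obtain ⟨f, hf⟩ := h.choose_spec
  have := hA.isDiscreteValuationRing p
  exact hf.localLength_eq_mult p

theorem IsKrullDomain.localLength_ne_top (hA : IsKrullDomain A) (hN : Module.IsTorsion A N)
    (p : HeightOnePrime A) : localLength p.1.asIdeal N ≠ ⊤ := by
  obtain ⟨D, -, hD⟩ := hA.exists_charIdeal_eq hN
  rw [hD p]
  exact ENat.natCast_ne_top _

theorem IsKrullDomain.charIdeal_eq_iff (hA : IsKrullDomain A) (hN : Module.IsTorsion A N)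
    (hN' : Module.IsTorsion A N') : charIdeal A N = charIdeal A N' ↔
      ∀ p : HeightOnePrime A, localLength p.1.asIdeal N = localLength p.1.asIdeal N' := by
  obtain ⟨D, hD, hDp⟩ := hA.exists_charIdeal_eq hN
  obtain ⟨D', hD', hDp'⟩ := hA.exists_charIdeal_eq hN'
  simp_rw [hD, hD', hA.ideal_eq_iff, hDp, hDp', Nat.cast_inj]

end StructureTheorem

section PowerSeriesPrimes

open PowerSeries

variable {A : Type*} [CommRing A]

theorem IsKrullDomain.exists_eq_mul_of_cross_mul_eq [IsDomain A] (hA : IsKrullDomain A)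
    {ι : Type*} (u v : ι → A) (huv : ∀ i j, u i * v j = u j * v i) (h0 : ∃ i, u i ≠ 0)
    (hu : ∀ p : HeightOnePrime A, ∃ i, u i ∉ p.1.asIdeal) : ∃ a, ∀ i, v i = a * u i := by
  obtain ⟨i₀, hi₀⟩ := h0
  let K := FractionRing A
  have algebraMap_ne_zero {x : A} (hx : x ≠ 0) : algebraMap A K x ≠ 0 :=
    IsFractionRing.to_map_ne_zero_of_mem_nonZeroDivisors (mem_nonZeroDivisors_of_ne_zero hx)
  have ratio_mem : algebraMap A K (v i₀) * (algebraMap A K (u i₀))⁻¹ ∈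
      ⨅ p : HeightOnePrime A, Localization.subalgebra.ofField K p.1.asIdeal.primeCompl
        (Ideal.primeCompl_le_nonZeroDivisors p.1.asIdeal) := by
    rw [Algebra.mem_iInf]
    intro p
    obtain ⟨i, hi⟩ := hu p
    refine ⟨v i, u i, hi, ?_⟩
    have hi0 : u i ≠ 0 := fun h => hi (h ▸ zero_mem _)
    rw [← div_eq_mul_inv, ← div_eq_mul_inv, div_eq_div_iff (algebraMap_ne_zero hi₀)
      (algebraMap_ne_zero hi0), ← map_mul, ← map_mul, mul_comm, huv i i₀, mul_comm]
  rw [hA.iInf_localization, Algebra.mem_bot] at ratio_mem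
  obtain ⟨a, ha⟩ := ratio_mem
  have ha' : v i₀ = a * u i₀ := by
    apply IsFractionRing.injective A K
    rw [map_mul, ha, inv_mul_cancel_right₀ (algebraMap_ne_zero hi₀)]
  refine ⟨a, fun i => mul_left_cancel₀ hi₀ ?_⟩
  rw [huv i₀ i, ha']
  ring

theorem span_X_le_jacobson : Ideal.span {(X : A⟦X⟧)} ≤ Ideal.jacobson ⊥ := by
  rw [Ideal.span_singleton_le_iff_mem, Ideal.mem_jacobson_bot]
  intro y
  rw [PowerSeries.isUnit_iff_constantCoeff]
  simp

theorem exists_mem_constantCoeff_ne_zero {P : Ideal A⟦X⟧} [P.IsPrime] (hP : P ≠ ⊥)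
    (hX : X ∉ P) : ∃ f ∈ P, constantCoeff f ≠ 0 := by
  obtain ⟨f, hf, hf0⟩ := (Submodule.ne_bot_iff _).1 hP
  refine ⟨divXPowOrder f, ?_, mt constantCoeff_divXPowOrder_eq_zero_iff.1 hf0⟩
  rw [← X_pow_order_mul_divXPowOrder (f := f)] at hf
  exact (‹P.IsPrime›.mem_or_mem hf).resolve_left fun h => hX (‹P.IsPrime›.mem_of_pow_mem _ h)

theorem IsKrullDomain.exists_eq_mul_C_add_X_mul [IsDomain A] (hA : IsKrullDomain A)
    {P : Ideal A⟦X⟧} (h0 : ∃ f ∈ P, constantCoeff f ≠ 0)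
    (hP : ∀ p : HeightOnePrime A, ¬ P.map constantCoeff ≤ p.1.asIdeal)
    {b c : A⟦X⟧} (hb : b ≠ 0) (hc : ∀ f ∈ P, b ∣ c * f) :
    ∃ (a : A) (c' : A⟦X⟧), c = b * C a + X * c' ∧ ∀ f ∈ P, b ∣ c' * f := by
  have b_dvd (f : P) : b ∣ c * f.1 := hc f.1 f.2
  choose φ hφ using b_dvd
  -- The power series `φ f = (c / b) * f` have proportional constant coefficients.
  obtain ⟨a, ha⟩ := hA.exists_eq_mul_of_cross_mul_eq (fun f : P => constantCoeff f.1)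
    (fun f => constantCoeff (φ f))
    (fun f g => by
      rw [← map_mul, ← map_mul]
      congr 1
      apply mul_left_cancel₀ hb
      rw [mul_left_comm, ← hφ, mul_left_comm b, ← hφ]
      ring)
    (by simpa using h0)
    (fun p => by simpa [Ideal.map_le_iff_le_comap, SetLike.not_le_iff_exists] using hP p)
  have X_dvd (f : P) : X ∣ φ f - C a * f.1 := by
    rw [X_dvd_iff, map_sub, map_mul, constantCoeff_C, ha, sub_self]
  choose ψ hψ using X_dvd
  have sub_mul_eq (f : P) : (c - b * C a) * f.1 = X * (b * ψ f) := by
    rw [mul_left_comm, ← hψ, sub_mul, hφ]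
    ring
  obtain ⟨f₀, hf₀P, hf₀⟩ := h0
  obtain ⟨c', hc'⟩ : X ∣ c - b * C a :=
    (X_prime.dvd_or_dvd ⟨_, sub_mul_eq ⟨f₀, hf₀P⟩⟩).resolve_right (mt X_dvd_iff.1 hf₀)
  refine ⟨a, c', by rw [← hc', add_sub_cancel], fun f hf => ⟨ψ ⟨f, hf⟩, ?_⟩⟩
  apply mul_left_cancel₀ (X_ne_zero (R := A))
  rw [← mul_assoc, ← hc', sub_mul_eq ⟨f, hf⟩]

theorem IsKrullDomain.dvd_of_forall_dvd_mul [IsDomain A] [IsNoetherianRing A]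
    (hA : IsKrullDomain A) {P : Ideal A⟦X⟧} (h0 : ∃ f ∈ P, constantCoeff f ≠ 0)
    (hP : ∀ p : HeightOnePrime A, ¬ P.map constantCoeff ≤ p.1.asIdeal)
    {b c : A⟦X⟧} (hb : b ≠ 0) (hc : ∀ f ∈ P, b ∣ c * f) : b ∣ c := by
  let J : Ideal A⟦X⟧ := (Ideal.span {b}).colon P
  have mem_J {c : A⟦X⟧} : c ∈ J ↔ ∀ f ∈ P, b ∣ c * f := by
    simp [J, Submodule.mem_colon, Ideal.mem_span_singleton]
  have J_le : J ≤ Ideal.span {b} ⊔ Ideal.span {(X : A⟦X⟧)} • J := by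
    intro c hc
    obtain ⟨a, c', rfl, hc'⟩ := hA.exists_eq_mul_C_add_X_mul h0 hP hb (mem_J.1 hc)
    exact Submodule.add_mem_sup (Ideal.mul_mem_right _ _ (Ideal.mem_span_singleton_self b))
      (Submodule.smul_mem_smul (Ideal.mem_span_singleton_self X) (mem_J.2 hc'))
  exact Ideal.mem_span_singleton.1 (Submodule.le_of_le_smul_of_le_jacobson_bot
    (IsNoetherian.noetherian J) span_X_le_jacobson J_le (mem_J.2 hc))

theorem exists_eq_colon_of_height_eq_one {B : Type*} [CommRing B] [IsDomain B]
    [IsNoetherianRing B] {P : Ideal B} [P.IsPrime] (hP : P.height = 1) :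
    ∃ b c : B, b ≠ 0 ∧ ∀ f, f ∈ P ↔ b ∣ c * f := by
  obtain ⟨b, hb, hb0⟩ := (Submodule.ne_bot_iff _).1 (Ideal.ne_bot_of_height_eq_one hP)
  have hmin : P ∈ (Ideal.span {b}).minimalPrimes := by
    refine Ideal.mem_minimalPrimes_of_height_le ((Ideal.span_singleton_le_iff_mem _).2 hb) ?_
    rw [hP]
    exact Ideal.one_le_height_span_singleton_of_mem_nonZeroDivisors
      (mem_nonZeroDivisors_of_ne_zero hb0)
  have hass : P ∈ associatedPrimes B (B ⧸ Ideal.span {b}) := by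
    apply Module.associatedPrimes.minimalPrimes_annihilator_subset_associatedPrimes
    rwa [Ideal.annihilator_quotient]
  obtain ⟨-, x, hx⟩ := isAssociatedPrime_iff.1 hass
  obtain ⟨c, rfl⟩ := Ideal.Quotient.mk_surjective x
  refine ⟨b, c, hb0, fun f => ?_⟩
  rw [hx, Submodule.mem_colon_singleton, Submodule.mem_bot, Algebra.smul_def,
    Ideal.Quotient.algebraMap_eq, ← map_mul, Ideal.Quotient.eq_zero_iff_mem,
    Ideal.mem_span_singleton, mul_comm]

theorem IsKrullDomain.exists_map_constantCoeff_le [IsDomain A] [IsNoetherianRing A]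
    (hA : IsKrullDomain A) {P : Ideal A⟦X⟧} [P.IsPrime] (hP : P.height = 1) (hX : X ∉ P) :
    ∃ p : HeightOnePrime A, P.map constantCoeff ≤ p.1.asIdeal := by
  by_contra! h
  obtain ⟨b, c, hb, mem_P⟩ := exists_eq_colon_of_height_eq_one hP
  have hbc : b ∣ c := hA.dvd_of_forall_dvd_mul
    (exists_mem_constantCoeff_ne_zero (Ideal.ne_bot_of_height_eq_one hP) hX) h hb
    fun f => (mem_P f).1
  exact ‹P.IsPrime›.one_notMem ((mem_P 1).2 (by rwa [mul_one]))

theorem height_comap_constantCoeff_le [IsNoetherianRing A] (p : Ideal A) [p.IsPrime] :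
    (p.comap (constantCoeff (R := A))).height ≤ p.height + 1 := by
  have hX : (X : A⟦X⟧) ∈ p.comap (constantCoeff (R := A)) := by simp
  refine (Ideal.height_le_height_add_one_of_mem hX).trans (add_le_add_left (le_of_eq ?_) 1)
  have ker_eq : RingHom.ker (constantCoeff (R := A)) = Ideal.span {X} := by
    ext f
    rw [RingHom.mem_ker, Ideal.mem_span_singleton, X_dvd_iff]
  let e : A⟦X⟧ ⧸ Ideal.span {(X : A⟦X⟧)} ≃+* A :=
    (Ideal.quotEquivOfEq ker_eq.symm).trans
      (RingHom.quotientKerEquivOfSurjective constantCoeff_surj)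
  have comap_eq : p.comap (constantCoeff (R := A)) =
    (p.comap (e : A⟦X⟧ ⧸ Ideal.span {(X : A⟦X⟧)} →+* A)).comap (Ideal.Quotient.mk _) := rfl
  rw [comap_eq, Ideal.map_comap_of_surjective _ Ideal.Quotient.mk_surjective]
  exact RingEquiv.height_comap e p

variable [IsDomain A]

theorem IsKrullDomain.two_le_height_iff_of_X_notMem [IsNoetherianRing A] (hA : IsKrullDomain A)
    {P : Ideal A⟦X⟧} [P.IsPrime] (hP : P ≠ ⊥) (hX : X ∉ P) :
    2 ≤ P.height ↔ ∀ p : HeightOnePrime A, ¬ P.map constantCoeff ≤ p.1.asIdeal := by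
  refine ⟨fun h p hPp => ?_, fun h => ?_⟩
  · rw [Ideal.map_le_iff_le_comap] at hPp
    have hlt : P < p.1.asIdeal.comap (constantCoeff (R := A)) :=
      lt_of_le_of_ne hPp fun h' => hX (h' ▸ by simp)
    have three_le : (2 + 1 : ℕ∞) ≤ 1 + 1 := calc
      _ ≤ P.height + 1 := add_le_add_left h 1
      _ ≤ (p.1.asIdeal.comap constantCoeff).height := Ideal.height_add_one_le_of_lt_of_isPrime hlt
      _ ≤ 1 + 1 := (height_comap_constantCoeff_le p.1.asIdeal).trans_eq (by rw [p.2])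
    exact absurd three_le (by decide)
  · by_contra! hlt
    have height_eq : P.height = 1 := le_antisymm (Order.le_of_lt_add_one hlt)
      (Order.one_le_iff_ne_zero.2 (Ideal.height_eq_zero_iff_eq_bot.not.2 hP))
    obtain ⟨p, hp⟩ := hA.exists_map_constantCoeff_le height_eq hX
    exact h p hp

theorem two_le_height_of_X_mem {I : Ideal A⟦X⟧} (hX : X ∈ I) {f : A⟦X⟧} (hf : f ∈ I)
    (hf0 : constantCoeff f ≠ 0) : 2 ≤ I.height := by
  rw [two_le_height_iff]
  intro p hp hIp
  have : (Ideal.span {(X : A⟦X⟧)}).IsPrime := span_X_isPrime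
  have hlt : Ideal.span {X} < p.asIdeal :=
    lt_of_le_of_ne ((Ideal.span_singleton_le_iff_mem _).2 (hIp hX)) fun h =>
      hf0 (X_dvd_iff.1 (Ideal.mem_span_singleton.1 (h ▸ hIp hf)))
  have two_le_one : (1 + 1 : ℕ∞) ≤ 1 := calc
    _ ≤ (Ideal.span {(X : A⟦X⟧)}).height + 1 :=
      add_le_add_left (Ideal.one_le_height_span_singleton_of_mem_nonZeroDivisors
        (mem_nonZeroDivisors_of_ne_zero X_ne_zero)) 1
    _ ≤ p.asIdeal.height := Ideal.height_add_one_le_of_lt_of_isPrime hlt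
    _ ≤ 1 := hp
  exact absurd two_le_one (by decide)

end PowerSeriesPrimes

section SnakeLemma

variable {R : Type*} [CommRing R] (r : R) {N₁ N₂ N₃ : Type*} [AddCommGroup N₁] [Module R N₁]
  [AddCommGroup N₂] [Module R N₂] [AddCommGroup N₃] [Module R N₃]

/-- The action of the functor `N ↦ N[r]`, the kernel of multiplication by `r`, on morphisms. -/
def torsionByMap (f : N₁ →ₗ[R] N₂) :
    Submodule.torsionBy R N₁ r →ₗ[R] Submodule.torsionBy R N₂ r :=
  f.restrict fun x hx => by
    rw [Submodule.mem_torsionBy_iff] at hx ⊢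
    rw [← map_smul, hx, map_zero]

variable {f : N₁ →ₗ[R] N₂} {g : N₂ →ₗ[R] N₃}

theorem torsionByMap_injective (hf : Function.Injective f) :
    Function.Injective (torsionByMap r f) :=
  fun _ _ h => Subtype.ext (hf (congrArg Subtype.val h))

theorem torsionByMap_exact (hf : Function.Injective f) (hfg : Function.Exact f g) :
    Function.Exact (torsionByMap r f) (torsionByMap r g) := by
  rintro ⟨x, hx⟩
  constructor
  · intro h
    obtain ⟨y, rfl⟩ := (hfg x).1 (congrArg Subtype.val h)
    exact ⟨⟨y, hf ((f.map_smul r y).trans (hx.trans f.map_zero.symm))⟩, rfl⟩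
  · rintro ⟨y, hy⟩
    rw [← hy]
    exact Subtype.ext (hfg.apply_apply_eq_zero y.1)

theorem exact_torsionBy_subtype (N : Type*) [AddCommGroup N] [Module R N] :
    Function.Exact (Submodule.torsionBy R N r).subtype (DistribSMul.toLinearMap R N r) :=
  LinearMap.exact_subtype_ker_map _

theorem exact_smul_top_mkQ (N : Type*) [AddCommGroup N] [Module R N] :
    Function.Exact (DistribSMul.toLinearMap R N r) (r • (⊤ : Submodule R N)).mkQ := by
  rw [LinearMap.exact_iff, Submodule.ker_mkQ]
  exact (LinearMap.range_eq_map _).symm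

theorem exists_exact_torsionBy_quotSMulTop (hf : Function.Injective f)
    (hg : Function.Surjective g) (hfg : Function.Exact f g) :
    ∃ δ : Submodule.torsionBy R N₃ r →ₗ[R] QuotSMulTop r N₁,
      Function.Exact (torsionByMap r g) δ ∧ Function.Exact δ (QuotSMulTop.map r f) := by
  have hf_comm : f ∘ₗ DistribSMul.toLinearMap R N₁ r = DistribSMul.toLinearMap R N₂ r ∘ₗ f :=
    LinearMap.ext (f.map_smul r)
  have hg_comm : g ∘ₗ DistribSMul.toLinearMap R N₂ r = DistribSMul.toLinearMap R N₃ r ∘ₗ g :=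
    LinearMap.ext (g.map_smul r)
  exact ⟨SnakeLemma.δ' _ _ _ f g hfg f g hfg hf_comm hg_comm _ (exact_torsionBy_subtype r N₃) _
      (exact_smul_top_mkQ r N₁) hg hf,
    SnakeLemma.exact_δ'_right _ _ _ _ _ _ _ _ _ _ _ _ (exact_torsionBy_subtype r N₂) _ _ _ _ _ _
      (torsionByMap r g) rfl (Submodule.subtype_injective _),
    SnakeLemma.exact_δ'_left _ _ _ _ _ _ _ _ _ _ _ _ _ _ _ _ (exact_smul_top_mkQ r N₂) _ _
      (QuotSMulTop.map r f) rfl (Submodule.mkQ_surjective _)⟩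

end SnakeLemma

section EulerCharacteristic

open PowerSeries

variable {A : Type*} [CommRing A]

/-- The Euler characteristic at `p` of multiplication by `X` on `N`: the difference of the local
lengths of `N / XN` and `N[X]`, with junk value if one of the two is infinite. -/
noncomputable def eulerChar (p : Ideal A) [p.IsPrime] (N : Type*) [AddCommGroup N] [Module A N]
    [Module A⟦X⟧ N] [IsScalarTower A A⟦X⟧ N] : ℤ :=
  (localLength p (QuotSMulTop (X : A⟦X⟧) N)).toNat -
    (localLength p (Submodule.torsionBy A⟦X⟧ N (X : A⟦X⟧))).toNat

variable {N N' : Type*} [AddCommGroup N] [Module A⟦X⟧ N] [AddCommGroup N'] [Module A⟦X⟧ N']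

section IsTorsionBy

variable [Module A N] [IsScalarTower A A⟦X⟧ N]

theorem smul_eq_constantCoeff_smul {x : N} (hx : (X : A⟦X⟧) • x = 0) (f : A⟦X⟧) :
    f • x = constantCoeff f • x := by
  conv_lhs => rw [eq_X_mul_shift_add_const f, add_smul, mul_comm, mul_smul, hx, smul_zero, zero_add]
  exact algebraMap_smul A⟦X⟧ (constantCoeff f) x

variable (hX : Module.IsTorsionBy A⟦X⟧ N X)
include hX

theorem finite_of_isTorsionBy_X [Module.Finite A⟦X⟧ N] : Module.Finite A N := by
  obtain ⟨s, hs⟩ := Module.Finite.fg_top (R := A⟦X⟧) (M := N)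
  refine ⟨⟨s, eq_top_iff.2 fun x _ => ?_⟩⟩
  have hx : x ∈ Submodule.span A⟦X⟧ (s : Set N) := hs ▸ Submodule.mem_top
  induction hx using Submodule.span_induction with
  | mem x hx => exact Submodule.subset_span hx
  | zero => exact zero_mem _
  | add x y _ _ hx hy => exact add_mem (hx trivial) (hy trivial)
  | smul f x _ hx =>
    rw [smul_eq_constantCoeff_smul (hX (x := x))]
    exact Submodule.smul_mem _ _ (hx trivial)

theorem constantCoeff_mem_annihilator {f : A⟦X⟧} (hf : f ∈ Module.annihilator A⟦X⟧ N) :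
    constantCoeff f ∈ Module.annihilator A N :=
  Module.mem_annihilator.2 fun x => by
    rw [← smul_eq_constantCoeff_smul (hX (x := x)), Module.mem_annihilator.1 hf]

theorem eulerChar_eq_zero_of_isTorsionBy_X (p : Ideal A) [p.IsPrime] : eulerChar p N = 0 := by
  have smul_top : (X : A⟦X⟧) • (⊤ : Submodule A⟦X⟧ N) = ⊥ :=
    (LinearMap.range_eq_map _).symm.trans (LinearMap.range_eq_bot.2 (LinearMap.ext fun _ => @hX _))
  let e : QuotSMulTop (X : A⟦X⟧) N ≃ₗ[A⟦X⟧] Submodule.torsionBy A⟦X⟧ N (X : A⟦X⟧) :=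
    Submodule.quotEquivOfEqBot _ smul_top ≪≫ₗ
      (LinearEquiv.ofTop _ ((Module.isTorsionBy_iff_torsionBy_eq_top _).1 hX)).symm
  rw [eulerChar, localLength_congr p (e.restrictScalars A), sub_self]

theorem isTorsion_of_isTorsionBy_X [IsDomain A] {f : A⟦X⟧} (hf : f ∈ Module.annihilator A⟦X⟧ N)
    (hf0 : constantCoeff f ≠ 0) : Module.IsTorsion A N := fun {x} =>
  ⟨⟨_, mem_nonZeroDivisors_of_ne_zero hf0⟩,
    Module.mem_annihilator.1 (constantCoeff_mem_annihilator hX hf) x⟩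

omit [Module A N] [IsScalarTower A A⟦X⟧ N] in
theorem isPseudoNull_of_isTorsionBy_X [IsDomain A] [Module.Finite A⟦X⟧ N] {f : A⟦X⟧}
    (hf : f ∈ Module.annihilator A⟦X⟧ N) (hf0 : constantCoeff f ≠ 0) : IsPseudoNull A⟦X⟧ N :=
  isPseudoNull_iff_two_le_height.2
    (two_le_height_of_X_mem (Module.mem_annihilator.2 fun _ => @hX _) hf hf0)

end IsTorsionBy

instance finite_quotSMulTop_X [Module A N] [IsScalarTower A A⟦X⟧ N] [Module.Finite A⟦X⟧ N] :
    Module.Finite A (QuotSMulTop (X : A⟦X⟧) N) :=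
  finite_of_isTorsionBy_X (Module.isTorsionBy_quotient_element_smul N X)

instance finite_torsionBy_X [IsNoetherianRing A] [Module A N] [IsScalarTower A A⟦X⟧ N]
    [Module.Finite A⟦X⟧ N] : Module.Finite A (Submodule.torsionBy A⟦X⟧ N (X : A⟦X⟧)) :=
  finite_of_isTorsionBy_X (Submodule.torsionBy_isTorsionBy X)

variable [Module A N] [IsScalarTower A A⟦X⟧ N] [Module A N'] [IsScalarTower A A⟦X⟧ N']

theorem eulerChar_congr (p : Ideal A) [p.IsPrime] (e : N ≃ₗ[A⟦X⟧] N') :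
    eulerChar p N = eulerChar p N' := by
  let e' : Submodule.torsionBy A⟦X⟧ N (X : A⟦X⟧) ≃ₗ[A⟦X⟧] Submodule.torsionBy A⟦X⟧ N' (X : A⟦X⟧) :=
    .ofLinearMap (torsionByMap X e.toLinearMap) (torsionByMap X e.symm.toLinearMap)
      (LinearMap.ext fun x => Subtype.ext (e.apply_symm_apply x))
      (LinearMap.ext fun x => Subtype.ext (e.symm_apply_apply x))
  rw [eulerChar, eulerChar, localLength_congr p (e'.restrictScalars A),
    localLength_congr p ((QuotSMulTop.congr X e).restrictScalars A)]

theorem annihilator_quotSMulTop_quotient (P : Ideal A⟦X⟧) :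
    Module.annihilator A (QuotSMulTop (X : A⟦X⟧) (A⟦X⟧ ⧸ P)) = P.map constantCoeff := by
  apply le_antisymm
  · intro a ha
    have C_smul_eq_zero := Module.mem_annihilator.1 ha (Submodule.Quotient.mk 1)
    rw [← algebraMap_smul A⟦X⟧ a, ← Submodule.Quotient.mk_smul, Submodule.Quotient.mk_eq_zero,
      Submodule.mem_smul_pointwise_iff_exists] at C_smul_eq_zero
    obtain ⟨y, -, hy⟩ := C_smul_eq_zero
    obtain ⟨g, rfl⟩ := Ideal.Quotient.mk_surjective y
    have sub_mem : C a * 1 - X * g ∈ P := Ideal.Quotient.eq.1 hy.symm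
    simpa using Ideal.mem_map_of_mem constantCoeff sub_mem
  · rw [Ideal.map_le_iff_le_comap]
    intro f hf
    refine constantCoeff_mem_annihilator (Module.isTorsionBy_quotient_element_smul _ X)
      (LinearMap.annihilator_le_of_surjective _ (Submodule.mkQ_surjective _) ?_)
    rwa [Ideal.annihilator_quotient]

theorem localLength_torsionBy_X_quotient {P : Ideal A⟦X⟧} [P.IsPrime] (hX : X ∉ P) (p : Ideal A)
    [p.IsPrime] : localLength p (Submodule.torsionBy A⟦X⟧ (A⟦X⟧ ⧸ P) (X : A⟦X⟧)) = 0 := by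
  have torsionBy_eq_bot : Submodule.torsionBy A⟦X⟧ (A⟦X⟧ ⧸ P) (X : A⟦X⟧) = ⊥ := by
    rw [eq_bot_iff]
    intro x hx
    obtain ⟨f, rfl⟩ := Ideal.Quotient.mk_surjective x
    have hf : X * f ∈ P := Ideal.Quotient.eq_zero_iff_mem.1 hx
    exact Ideal.Quotient.eq_zero_iff_mem.2 ((‹P.IsPrime›.mem_or_mem hf).resolve_left hX)
  have := (Submodule.subsingleton_iff_eq_bot).2 torsionBy_eq_bot
  rw [localLength_eq_zero_iff_subsingleton]
  infer_instance

theorem exists_mem_annihilator_constantCoeff_ne_zero [IsDomain A]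
    [Module.Finite A⟦X⟧ N] (hN : Module.IsTorsion A (QuotSMulTop (X : A⟦X⟧) N)) :
    ∃ f ∈ Module.annihilator A⟦X⟧ N, constantCoeff f ≠ 0 := by
  obtain ⟨a, ha, ha0⟩ := (Submodule.ne_bot_iff _).1 (isTorsion_iff_annihilator_ne_bot.1 hN)
  have C_mem : C a ∈ Module.annihilator A⟦X⟧ (QuotSMulTop (X : A⟦X⟧) N) :=
    Module.mem_annihilator.2 fun x =>
      (algebraMap_smul A⟦X⟧ a x).trans (Module.mem_annihilator.1 ha x)
  have C_mem_radical : C a ∈ (Module.annihilator A⟦X⟧ N ⊔ Ideal.span {X}).radical := by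
    rw [← PrimeSpectrum.vanishingIdeal_zeroLocus_eq_radical, PrimeSpectrum.zeroLocus_sup,
      PrimeSpectrum.zeroLocus_span, ← Module.support_eq_zeroLocus, ← Module.support_quotSMulTop,
      Module.support_eq_zeroLocus, PrimeSpectrum.vanishingIdeal_zeroLocus_eq_radical]
    exact Ideal.le_radical C_mem
  obtain ⟨n, hn⟩ := C_mem_radical
  obtain ⟨f, hf, g, hg, hfg⟩ := Submodule.mem_sup.1 hn
  refine ⟨f, hf, ?_⟩
  have := congrArg constantCoeff hfg
  rw [map_add, X_dvd_iff.1 (Ideal.mem_span_singleton.1 hg), add_zero, map_pow,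
    constantCoeff_C] at this
  rw [this]
  exact pow_ne_zero n ha0

theorem isTorsion_torsionBy_X [IsDomain A]
    (hN : ∃ f ∈ Module.annihilator A⟦X⟧ N, constantCoeff f ≠ 0) :
    Module.IsTorsion A (Submodule.torsionBy A⟦X⟧ N (X : A⟦X⟧)) := by
  obtain ⟨f, hf, hf0⟩ := hN
  have hf' : f ∈ Module.annihilator A⟦X⟧ (Submodule.torsionBy A⟦X⟧ N (X : A⟦X⟧)) :=
    LinearMap.annihilator_le_of_injective _ (Submodule.subtype_injective _) hf
  exact isTorsion_of_isTorsionBy_X (Submodule.torsionBy_isTorsionBy X) hf' hf0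

theorem isTorsion_quotSMulTop_X [IsDomain A]
    (hN : ∃ f ∈ Module.annihilator A⟦X⟧ N, constantCoeff f ≠ 0) :
    Module.IsTorsion A (QuotSMulTop (X : A⟦X⟧) N) := by
  obtain ⟨f, hf, hf0⟩ := hN
  have hf' : f ∈ Module.annihilator A⟦X⟧ (QuotSMulTop (X : A⟦X⟧) N) :=
    LinearMap.annihilator_le_of_surjective _ (Submodule.mkQ_surjective _) hf
  exact isTorsion_of_isTorsionBy_X (Module.isTorsionBy_quotient_element_smul N X) hf' hf0

namespace IsKrullDomain

variable [IsDomain A] [IsNoetherianRing A] (hA : IsKrullDomain A) [Module.Finite A⟦X⟧ N]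
  (hN : ∃ f ∈ Module.annihilator A⟦X⟧ N, constantCoeff f ≠ 0) (p : HeightOnePrime A)
include hA hN

theorem localLength_quotSMulTop_X_ne_top :
    localLength p.1.asIdeal (QuotSMulTop (X : A⟦X⟧) N) ≠ ⊤ :=
  hA.localLength_ne_top (isTorsion_quotSMulTop_X hN) p

theorem localLength_torsionBy_X_ne_top :
    localLength p.1.asIdeal (Submodule.torsionBy A⟦X⟧ N (X : A⟦X⟧)) ≠ ⊤ :=
  hA.localLength_ne_top (isTorsion_torsionBy_X hN) p

theorem eulerChar_eq_zero_iff : eulerChar p.1.asIdeal N = 0 ↔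
    localLength p.1.asIdeal (Submodule.torsionBy A⟦X⟧ N (X : A⟦X⟧)) =
      localLength p.1.asIdeal (QuotSMulTop (X : A⟦X⟧) N) := by
  rw [eulerChar, sub_eq_zero, Nat.cast_inj, eq_comm, ← Nat.cast_inj (R := ℕ∞),
    ENat.natCast_toNat (hA.localLength_torsionBy_X_ne_top hN p),
    ENat.natCast_toNat (hA.localLength_quotSMulTop_X_ne_top hN p)]

omit hN in
theorem eulerChar_eq_add {N₁ N₂ N₃ : Type*}
    [AddCommGroup N₁] [Module A N₁] [Module A⟦X⟧ N₁] [IsScalarTower A A⟦X⟧ N₁]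
    [AddCommGroup N₂] [Module A N₂] [Module A⟦X⟧ N₂] [IsScalarTower A A⟦X⟧ N₂]
    [AddCommGroup N₃] [Module A N₃] [Module A⟦X⟧ N₃] [IsScalarTower A A⟦X⟧ N₃]
    [Module.Finite A⟦X⟧ N₁] [Module.Finite A⟦X⟧ N₂] [Module.Finite A⟦X⟧ N₃]
    {i : N₁ →ₗ[A⟦X⟧] N₂} {q : N₂ →ₗ[A⟦X⟧] N₃} (hi : Function.Injective i)
    (hq : Function.Surjective q) (hiq : Function.Exact i q)
    (h₂ : ∃ f ∈ Module.annihilator A⟦X⟧ N₂, constantCoeff f ≠ 0) (p : HeightOnePrime A) :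
    eulerChar p.1.asIdeal N₂ = eulerChar p.1.asIdeal N₁ + eulerChar p.1.asIdeal N₃ := by
  have h₁ : ∃ f ∈ Module.annihilator A⟦X⟧ N₁, constantCoeff f ≠ 0 :=
    h₂.imp fun f => And.imp_left fun hf => LinearMap.annihilator_le_of_injective i hi hf
  have h₃ : ∃ f ∈ Module.annihilator A⟦X⟧ N₃, constantCoeff f ≠ 0 :=
    h₂.imp fun f => And.imp_left fun hf => LinearMap.annihilator_le_of_surjective q hq hf
  obtain ⟨δ, hqδ, hδi⟩ := exists_exact_torsionBy_quotSMulTop (X : A⟦X⟧) hi hq hiq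
  have six_term := localLength_add_add_eq_of_exact p.1.asIdeal
    (f₁ := (torsionByMap X i).restrictScalars A) (f₂ := (torsionByMap X q).restrictScalars A)
    (δ := δ.restrictScalars A) (g₁ := (QuotSMulTop.map X i).restrictScalars A)
    (g₂ := (QuotSMulTop.map X q).restrictScalars A) (torsionByMap_injective X hi)
    (torsionByMap_exact X hi hiq) hqδ hδi (QuotSMulTop.map_exact X hiq hq)
    (QuotSMulTop.map_surjective X hq)
  rw [← ENat.natCast_toNat (hA.localLength_torsionBy_X_ne_top h₁ p),
    ← ENat.natCast_toNat (hA.localLength_torsionBy_X_ne_top h₂ p),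
    ← ENat.natCast_toNat (hA.localLength_torsionBy_X_ne_top h₃ p),
    ← ENat.natCast_toNat (hA.localLength_quotSMulTop_X_ne_top h₁ p),
    ← ENat.natCast_toNat (hA.localLength_quotSMulTop_X_ne_top h₂ p),
    ← ENat.natCast_toNat (hA.localLength_quotSMulTop_X_ne_top h₃ p)] at six_term
  norm_cast at six_term
  simp only [eulerChar]
  omega

end IsKrullDomain

variable (A N) in
/-- The relation between Euler characteristics and pseudo-nullity that is propagated along prime
filtrations. Nonnegativity is what makes the vanishing criterion stable under extensions. -/
structure EulerCharCriterion : Prop where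
  nonneg (p : HeightOnePrime A) : 0 ≤ eulerChar p.1.asIdeal N
  isPseudoNull_iff :
    IsPseudoNull A⟦X⟧ N ↔ ∀ p : HeightOnePrime A, eulerChar p.1.asIdeal N = 0

theorem EulerCharCriterion.congr [IsDomain A] [Module.Finite A⟦X⟧ N] [Module.Finite A⟦X⟧ N']
    (h : EulerCharCriterion A N) (e : N ≃ₗ[A⟦X⟧] N') : EulerCharCriterion A N' where
  nonneg p := eulerChar_congr p.1.asIdeal e ▸ h.nonneg p
  isPseudoNull_iff := by
    simp_rw [← isPseudoNull_congr e, ← eulerChar_congr _ e]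
    exact h.isPseudoNull_iff

theorem EulerCharCriterion.of_isTorsionBy_X [IsDomain A] [Module.Finite A⟦X⟧ N]
    (hX : Module.IsTorsionBy A⟦X⟧ N X)
    (hN : ∃ f ∈ Module.annihilator A⟦X⟧ N, constantCoeff f ≠ 0) : EulerCharCriterion A N where
  nonneg p := (eulerChar_eq_zero_of_isTorsionBy_X hX p.1.asIdeal).ge
  isPseudoNull_iff :=
    have ⟨_, hf, hf0⟩ := hN
    iff_of_true (isPseudoNull_of_isTorsionBy_X hX hf hf0)
      fun p => eulerChar_eq_zero_of_isTorsionBy_X hX p.1.asIdeal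

namespace IsKrullDomain

variable [IsDomain A] [IsNoetherianRing A] (hA : IsKrullDomain A)
include hA

theorem eulerCharCriterion_quotient {P : Ideal A⟦X⟧} [P.IsPrime]
    (hP : ∃ f ∈ P, constantCoeff f ≠ 0) : EulerCharCriterion A (A⟦X⟧ ⧸ P) := by
  rw [← Ideal.annihilator_quotient (I := P)] at hP
  by_cases hX : X ∈ P
  · refine .of_isTorsionBy_X (fun x => ?_) hP
    obtain ⟨f, rfl⟩ := Ideal.Quotient.mk_surjective x
    exact Ideal.Quotient.eq_zero_iff_mem.2 (P.mul_mem_right f hX)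
  · constructor
    · intro p
      rw [eulerChar, localLength_torsionBy_X_quotient hX, ENat.toNat_zero, Nat.cast_zero, sub_zero]
      exact Int.natCast_nonneg _
    · have hP0 : P ≠ ⊥ := by
        rintro rfl
        obtain ⟨f, hf, hf0⟩ := hP
        rw [Ideal.annihilator_quotient, Ideal.mem_bot] at hf
        exact hf0 (by rw [hf, map_zero])
      simp_rw [isPseudoNull_iff_two_le_height, Ideal.annihilator_quotient,
        hA.two_le_height_iff_of_X_notMem hP0 hX, hA.eulerChar_eq_zero_iff hP,
        localLength_torsionBy_X_quotient hX, eq_comm (a := (0 : ℕ∞)),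
        localLength_eq_zero_iff_of_finite, annihilator_quotSMulTop_quotient]

theorem eulerCharCriterion_of_exact {N₁ N₂ N₃ : Type*}
    [AddCommGroup N₁] [Module A N₁] [Module A⟦X⟧ N₁] [IsScalarTower A A⟦X⟧ N₁]
    [AddCommGroup N₂] [Module A N₂] [Module A⟦X⟧ N₂] [IsScalarTower A A⟦X⟧ N₂]
    [AddCommGroup N₃] [Module A N₃] [Module A⟦X⟧ N₃] [IsScalarTower A A⟦X⟧ N₃]
    [Module.Finite A⟦X⟧ N₁] [Module.Finite A⟦X⟧ N₂] [Module.Finite A⟦X⟧ N₃]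
    {i : N₁ →ₗ[A⟦X⟧] N₂} {q : N₂ →ₗ[A⟦X⟧] N₃} (hi : Function.Injective i)
    (hq : Function.Surjective q) (hiq : Function.Exact i q)
    (h₂ : ∃ f ∈ Module.annihilator A⟦X⟧ N₂, constantCoeff f ≠ 0)
    (h₁ : EulerCharCriterion A N₁) (h₃ : EulerCharCriterion A N₃) : EulerCharCriterion A N₂ where
  nonneg p := by
    rw [hA.eulerChar_eq_add hi hq hiq h₂ p]
    exact add_nonneg (h₁.nonneg p) (h₃.nonneg p)
  isPseudoNull_iff := by
    rw [isPseudoNull_iff_of_exact hi hq hiq, h₁.isPseudoNull_iff, h₃.isPseudoNull_iff,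
      ← forall_and]
    refine forall_congr' fun p => ?_
    rw [hA.eulerChar_eq_add hi hq hiq h₂ p,
      add_eq_zero_iff_of_nonneg (h₁.nonneg p) (h₃.nonneg p)]

theorem eulerCharCriterion [hN_finite : Module.Finite A⟦X⟧ N]
    (hN : ∃ f ∈ Module.annihilator A⟦X⟧ N, constantCoeff f ≠ 0) : EulerCharCriterion A N := by
  suffices h : ∀ [Module A N] [IsScalarTower A A⟦X⟧ N],
      (∃ f ∈ Module.annihilator A⟦X⟧ N, constantCoeff f ≠ 0) → EulerCharCriterion A N from h hN
  clear hN
  induction hN_finite using IsNoetherianRing.induction_on_isQuotientEquivQuotientPrime A⟦X⟧ with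
  | subsingleton N =>
    intro _ _ hN
    exact .of_isTorsionBy_X (fun _ => Subsingleton.elim _ _) hN
  | quotient N P e =>
    intro _ _ hN
    have := P.2
    rw [e.annihilator_eq, Ideal.annihilator_quotient] at hN
    exact (hA.eulerCharCriterion_quotient hN).congr e.symm
  | exact N₁ N₂ N₃ i q hi hq hiq h₁ h₃ =>
    intro _ _ hN
    let : Module A N₁ := Module.compHom N₁ (algebraMap A A⟦X⟧)
    let : Module A N₃ := Module.compHom N₃ (algebraMap A A⟦X⟧)
    have : IsScalarTower A A⟦X⟧ N₁ := .of_algebraMap_smul fun _ _ => rfl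
    have : IsScalarTower A A⟦X⟧ N₃ := .of_algebraMap_smul fun _ _ => rfl
    have hN₁ := hN.imp fun f => And.imp_left fun hf => LinearMap.annihilator_le_of_injective i hi hf
    have hN₃ := hN.imp fun f => And.imp_left fun hf =>
      LinearMap.annihilator_le_of_surjective q hq hf
    exact hA.eulerCharCriterion_of_exact hi hq hiq hN (h₁ hN₁) (h₃ hN₃)

end IsKrullDomain

end EulerCharacteristic

theorem corollary2p8 {A M : Type*} [CommRing A] [IsDomain A] [IsNoetherianRing A]
    (hA : IsKrullDomain A) [AddCommGroup M] [Module A M] [Module A⟦X⟧ M]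
    [IsScalarTower A A⟦X⟧ M]
    (hMfin : Module.Finite A⟦X⟧ M) (hMtors : Module.IsTorsion A⟦X⟧ M)
    (hQfin : Module.Finite A (M ⧸ ((PowerSeries.X : A⟦X⟧) • (⊤ : Submodule A⟦X⟧ M))))
    (hQtors : Module.IsTorsion A (M ⧸ ((PowerSeries.X : A⟦X⟧) • (⊤ : Submodule A⟦X⟧ M)))) :
    (IsPseudoNull A⟦X⟧ M ↔
      charIdeal A (Submodule.torsionBy A⟦X⟧ M (PowerSeries.X : A⟦X⟧)) =
        charIdeal A (M ⧸ ((PowerSeries.X : A⟦X⟧) • (⊤ : Submodule A⟦X⟧ M)))) ∧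
    (IsPseudoNull A (M ⧸ ((PowerSeries.X : A⟦X⟧) • (⊤ : Submodule A⟦X⟧ M))) →
      IsPseudoNull A⟦X⟧ M) := by
  have hM := exists_mem_annihilator_constantCoeff_ne_zero hQtors
  have criterion := hA.eulerCharCriterion hM
  constructor
  · rw [criterion.isPseudoNull_iff, hA.charIdeal_eq_iff (isTorsion_torsionBy_X hM) hQtors]
    exact forall_congr' (hA.eulerChar_eq_zero_iff hM)
  · intro hQ
    refine criterion.isPseudoNull_iff.2 fun p => le_antisymm ?_ (criterion.nonneg p)
    rw [eulerChar, show localLength p.1.asIdeal (QuotSMulTop PowerSeries.X M) = 0 from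
      hQ.localLength_eq_zero p, ENat.toNat_zero, Nat.cast_zero, zero_sub]
    exact neg_nonpos.2 (Int.natCast_nonneg _)
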